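/- A tournament $G$ is a finite loopless directed graph in which any two distinct vertices are joined by exactly one edge; write $u\to v$ if there is an edge from $u$ to $v$. For $X\subseteq V(G)$, let $G[X]$ be the subtournament induced on $X$. A tournament $G$ is $H$-free if no induced subtournament of $G$ is isomorphic to $H$. A set $X\subseteq V(G)$ is transitive if $G[X]$ contains no cyclic triangle, i.e. no three distinct vertices $a,b,c$ with $a\to b\to c\to a$. A set $X\subseteq V(G)$ is homogeneous if for every $v\in V(G)\setminus X$, either $v\to x$ for all $x\in X$, or $x\to v$ for all $x\in X$; $G$ is prime if it has no homogeneous set $X$ with $1<|X|<|V(G)|$. Let $T_5$ be the tournament with vertices $v_1,\dots,v_5$ such that $v_i\to v_j$ if $j-i\equiv 1,2\pmod 5$. Let $U_5$ be the tournament with vertices $v_1,\dots,v_5$ such that $v_2\to v_1$, and $v_i\to v_j$ if $j-i\equiv 1,2\pmod 5$ and $\{i,j\}\ne\{1,2\}$. Theorem. Let $G$ be a prime tournament. Then $G$ is both $T_5$-free and $U_5$-free if and only if $V(G)$ can be partitioned into (possibly empty) sets $X,Y,Z$ such that $X\cup Y$, $Y\cup Z$ and $Z\cup X$ are transitive. 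-/

import Mathlib

/-- A tournament on the vertex set `V`: a loopless directed graph in which any two distinct
vertices are joined by exactly one edge. `G.Adj u v` means `u → v`. -/
structure Tournament (V : Type*) extends Digraph V where
  loopless : ∀ v, ¬ Adj v v
  exactly_one : ∀ u v, u ≠ v → Xor (Adj u v) (Adj v u)

namespace Tournament

variable {V W : Type*}

/-- The subtournament `G[X]` induced on `X`. -/
def induce (G : Tournament V) (X : Set V) : Tournament X where
  Adj u v := G.Adj u v
  loopless v := G.loopless v
  exactly_one u v h := G.exactly_one u v (fun e => h (Subtype.ext e))

/-- Isomorphism of tournaments. -/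
def Iso (G : Tournament V) (H : Tournament W) : Prop :=
  Nonempty (G.Adj ≃r H.Adj)

/-- `G` is `H`-free: no subtournament of `G` is isomorphic to `H`. -/
def Free (G : Tournament V) (H : Tournament W) : Prop :=
  ∀ X : Set V, ¬ (G.induce X).Iso H

/-- `X` is a cyclic triangle of `G`. -/
def IsCyclicTriangle (G : Tournament V) (X : Set V) : Prop :=
  ∃ a b c : V, a ≠ b ∧ b ≠ c ∧ c ≠ a ∧ X = {a, b, c} ∧ G.Adj a b ∧ G.Adj b c ∧ G.Adj c a

/-- A tournament is transitive if it has no cyclic triangle. -/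
def IsTransitive (G : Tournament V) : Prop :=
  ∀ X : Set V, ¬ G.IsCyclicTriangle X

/-- A set of vertices is transitive if it induces a transitive tournament. -/
def IsTransitiveSet (G : Tournament V) (X : Set V) : Prop :=
  (G.induce X).IsTransitive

/-- `X` is homogeneous if every vertex outside `X` either dominates all of `X` or is dominated
by all of `X`. -/
def IsHomogeneous (G : Tournament V) (X : Set V) : Prop :=
  ∀ v, v ∉ X → (∀ x ∈ X, G.Adj v x) ∨ (∀ x ∈ X, G.Adj x v)

/-- A (finite) tournament is prime if it has no homogeneous set `X` with `1 < |X| < |V(G)|`. -/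
def IsPrime (G : Tournament V) : Prop :=
  ∀ X : Set V, G.IsHomogeneous X → ¬ (1 < X.ncard ∧ X.ncard < Nat.card V)

/-- The tournament `T₅`: vertices `v₁, …, v₅` (indexed modulo `5`) with `vᵢ → vⱼ` if
`j - i ≡ 1, 2 (mod 5)`. -/
def T5 : Tournament (ZMod 5) where
  Adj i j := j - i = 1 ∨ j - i = 2
  loopless := by decide
  exactly_one := by unfold Xor; decide

/-- The tournament `U₅`: vertices `v₁, …, v₅` (indexed modulo `5`) with `v₂ → v₁`, and
`vᵢ → vⱼ` if `j - i ≡ 1, 2 (mod 5)` and `{i, j} ≠ {1, 2}`. -/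
def U5 : Tournament (ZMod 5) where
  Adj i j := (i = 2 ∧ j = 1) ∨
    ((j - i = 1 ∨ j - i = 2) ∧ ({i, j} : Finset (ZMod 5)) ≠ {1, 2})
  loopless := by decide
  exactly_one := by unfold Xor; decide

/-- `X, Y, Z` (possibly empty) partition the vertex set. -/
def IsTripartition (X Y Z : Set V) : Prop :=
  X ∪ Y ∪ Z = Set.univ ∧ Disjoint X Y ∧ Disjoint Y Z ∧ Disjoint Z X

end Tournament

namespace Tournament

variable {V W : Type*}

/-! ### Basic facts on arcs -/

/-! A valid partition amounts to a colouring by `ZMod 3` that increases by one along every arc of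
every cyclic triangle. Such a colouring is grown over strong sets. If `v` has both an in- and an
out-neighbour in a coloured strong set `S`, the excluded five-vertex tournaments force the triangles
through `v` to agree on one colour for it (`IsCyclicColoring.exists_insert`). At a maximal `S ≠
V(G)`, every outside vertex therefore dominates `S` or is dominated by it, and strong connectivity
gives `S → q → p → S`. Primeness with `U₅`-freeness rules this out unless `S` is a single vertex
(`IsPrime.not_strong_blowup`), and then the triangle on `S`, `q`, `p` is a larger coloured set.
Conversely, `T₅` and `U₅` each have four vertices, any two in a common cyclic triangle; two of the
four share a part, and that triangle lies in the union of two parts. -/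

theorem adj_ne (G : Tournament V) {u v : V} (h : G.Adj u v) : u ≠ v :=
  fun e => G.loopless v (e ▸ h)

theorem adj_asymm (G : Tournament V) {u v : V} (h : G.Adj u v) : ¬ G.Adj v u := by
  rcases G.exactly_one u v (G.adj_ne h) with h' | h'
  · exact h'.2
  · exact absurd h h'.2

theorem adj_or (G : Tournament V) {u v : V} (h : u ≠ v) : G.Adj u v ∨ G.Adj v u := by
  rcases G.exactly_one u v h with h' | h'
  · exact Or.inl h'.1
  · exact Or.inr h'.1

/-- An arc-preserving map between tournaments is an embedding. -/
theorem not_free_of_hom (G : Tournament V) (H : Tournament W) (g : W → V)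
    (hg : ∀ i j, H.Adj i j → G.Adj (g i) (g j)) : ¬ G.Free H := by
  intro hf
  have hinj : Function.Injective g := by
    intro i j e
    by_contra hne
    rcases H.adj_or hne with h | h
    · exact G.adj_ne (hg _ _ h) e
    · exact G.adj_ne (hg _ _ h) e.symm
  refine hf (Set.range g) ⟨RelIso.symm ⟨Equiv.ofInjective g hinj, ?_⟩⟩
  intro i j
  refine ⟨fun h => ?_, fun h => hg i j h⟩
  have h' : G.Adj (g i) (g j) := h
  by_contra hn
  have hne : i ≠ j := fun e => G.adj_ne h' (congrArg g e)
  rcases H.adj_or hne with h1 | h1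
  · exact hn h1
  · exact G.adj_asymm h' (hg _ _ h1)

/-- A copy of `H` in `G` is the image of an arc-preserving map. -/
theorem exists_hom_of_not_free (G : Tournament V) (H : Tournament W) (h : ¬ G.Free H) :
    ∃ g : W → V, ∀ i j, H.Adj i j → G.Adj (g i) (g j) := by
  unfold Free at h
  push Not at h
  obtain ⟨X, ⟨e⟩⟩ := h
  exact ⟨fun i => (e.symm i : V), fun i j hij => e.symm.map_rel_iff.2 hij⟩

/-! ### Forbidden configurations on five vertices -/

/-- No five vertices span a copy of `T₅`, listed by its arcs. -/
def NoT5 (G : Tournament V) : Prop :=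
  ∀ a b c d e : V, G.Adj a b → G.Adj a c → G.Adj b c → G.Adj b d → G.Adj c d → G.Adj c e →
    G.Adj d e → G.Adj d a → G.Adj e a → G.Adj e b → False

/-- No five vertices span a copy of `U₅`, listed by its arcs. -/
def NoU5 (G : Tournament V) : Prop :=
  ∀ a b c d e : V, G.Adj b a → G.Adj a c → G.Adj b c → G.Adj b d → G.Adj c d → G.Adj c e →
    G.Adj d e → G.Adj d a → G.Adj e a → G.Adj e b → False

/-- No cyclic triangle with one vertex replaced by a cyclic triangle. -/
def NoBlowup (G : Tournament V) : Prop :=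
  ∀ a b c x y : V, G.Adj a b → G.Adj b c → G.Adj c a → G.Adj a x → G.Adj b x → G.Adj c x →
    G.Adj x y → G.Adj y a → G.Adj y b → G.Adj y c → False

theorem Free.noT5 {G : Tournament V} (h : G.Free T5) : G.NoT5 := by
  intro a b c d e h1 h2 h3 h4 h5 h6 h7 h8 h9 h10
  refine not_free_of_hom G T5 (![a, b, c, d, e] : Fin 5 → V) ?_ h
  intro i j hij
  change Fin 5 at i j
  fin_cases i <;> fin_cases j <;> first
    | assumption
    | exact absurd hij (by unfold T5; decide)

theorem Free.noU5 {G : Tournament V} (h : G.Free U5) : G.NoU5 := by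
  intro a b c d e h1 h2 h3 h4 h5 h6 h7 h8 h9 h10
  have harcs : ∀ i j, U5.Adj i j → i = 2 ∧ j = 1 ∨ i = 1 ∧ j = 3 ∨ i = 2 ∧ j = 3 ∨
      i = 2 ∧ j = 4 ∨ i = 3 ∧ j = 4 ∨ i = 3 ∧ j = 0 ∨ i = 4 ∧ j = 0 ∨ i = 4 ∧ j = 1 ∨
      i = 0 ∧ j = 1 ∨ i = 0 ∧ j = 2 := by
    unfold U5
    decide
  -- The tuple starts at `e` because `v₅` has index `0`; `T₅` needs no such shift, being rotation
  -- invariant.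
  refine not_free_of_hom G U5 (![e, a, b, c, d] : Fin 5 → V) ?_ h
  intro i j hij
  rcases harcs i j hij with ⟨rfl, rfl⟩ | ⟨rfl, rfl⟩ | ⟨rfl, rfl⟩ | ⟨rfl, rfl⟩ | ⟨rfl, rfl⟩ |
    ⟨rfl, rfl⟩ | ⟨rfl, rfl⟩ | ⟨rfl, rfl⟩ | ⟨rfl, rfl⟩ | ⟨rfl, rfl⟩ <;> assumption

section Configurations

variable {G : Tournament V}

/-- Links two triangles at `v` by a third that shares a vertex other than `v` with each. If both
links fail, the two remaining undetermined arcs always complete a `U₅` or a blowup. -/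
theorem adj_or_adj_of_two_triangles (hU : G.NoU5) (hN : G.NoBlowup) {v a b c d : V}
    (h1 : G.Adj v a) (h2 : G.Adj a b) (h3 : G.Adj b v)
    (h4 : G.Adj v c) (h5 : G.Adj c d) (h6 : G.Adj d v) : G.Adj a d ∨ G.Adj c b := by
  by_contra hcon
  push Not at hcon
  have had : a ≠ d := fun e => G.adj_asymm h1 (e ▸ h6)
  have hcb : c ≠ b := fun e => G.adj_asymm h4 (e ▸ h3)
  have h7 := (G.adj_or had).resolve_left hcon.1
  have h8 := (G.adj_or hcb).resolve_left hcon.2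
  have hac : a ≠ c := fun e => hcon.2 (e ▸ h2)
  have hbd : b ≠ d := fun e => hcon.1 (e ▸ h2)
  rcases G.adj_or hac with h | h <;> rcases G.adj_or hbd with h' | h'
  · apply hU c b d v a <;> assumption
  · apply hN v a b c d <;> assumption
  · apply hN v c d a b <;> assumption
  · apply hU a d b v c <;> assumption

theorem not_adj_of_dominated_triangle (hU : G.NoU5) (hN : G.NoBlowup) {r s t w v : V}
    (h1 : G.Adj r s) (h2 : G.Adj s t) (h3 : G.Adj t r) (h4 : G.Adj w r) (h5 : G.Adj w s)
    (h6 : G.Adj w t) (h7 : G.Adj v w) (htv : t ≠ v) (h8 : G.Adj r v) : ¬ G.Adj s v := by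
  intro h9
  rcases G.adj_or htv with h | h
  · apply hN r s t v w <;> assumption
  · apply hU t w r s v <;> assumption

/-- The previous lemma with all arcs reversed. -/
theorem not_adj_of_dominating_triangle (hU : G.NoU5) (hN : G.NoBlowup) {r s t w v : V}
    (h1 : G.Adj r s) (h2 : G.Adj s t) (h3 : G.Adj t r) (h4 : G.Adj r w) (h5 : G.Adj s w)
    (h6 : G.Adj t w) (h7 : G.Adj w v) (htv : t ≠ v) (h8 : G.Adj v r) : ¬ G.Adj v s := by
  intro h9
  rcases G.adj_or htv with h | h
  · apply hU w t v r s <;> assumption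
  · apply hN r s t w v <;> assumption

/-- The arcs joining `v` to `q` and `r` have four orientations: two give `U₅`, one `T₅`, one a
blowup. Only here is `T₅` excluded directly. -/
theorem not_adj_of_four_path (hT : G.NoT5) (hU : G.NoU5) (hN : G.NoBlowup) {p q r s v : V}
    (h1 : G.Adj p q) (h2 : G.Adj q r) (h3 : G.Adj r s) (h4 : G.Adj r p) (h5 : G.Adj s p)
    (h6 : G.Adj s q) (hq : q ≠ v) (hr : r ≠ v) (h7 : G.Adj p v) : ¬ G.Adj v s := by
  intro h8
  rcases G.adj_or hq with h | h <;> rcases G.adj_or hr with h' | h'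
  · apply hU v r s p q <;> assumption
  · apply hT p q v r s <;> assumption
  · apply hN s p v q r <;> assumption
  · apply hU q v r s p <;> assumption

end Configurations

/-! ### Strong sets and shortest paths -/

/-- `S` induces a strongly connected subtournament. -/
def IsStrong (G : Tournament V) (S : Set V) : Prop :=
  ∀ a ∈ S, ∀ b ∈ S, Relation.ReflTransGen (fun x y => x ∈ S ∧ y ∈ S ∧ G.Adj x y) a b

theorem isStrong_singleton (G : Tournament V) (x : V) : G.IsStrong {x} := by
  rintro a rfl b rfl
  exact .refl

theorem IsStrong.exists_crossing {G : Tournament V} {S : Set V} (hS : G.IsStrong S)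
    (P : V → Prop) {a b : V} (ha : a ∈ S) (hb : b ∈ S) (hPa : P a) (hPb : ¬ P b) :
    ∃ x ∈ S, ∃ y ∈ S, G.Adj x y ∧ P x ∧ ¬ P y := by
  have h := hS a ha b hb
  clear hb
  induction h with
  | refl => exact absurd hPa hPb
  | @tail c d _ hcd ih =>
    by_cases hc : P c
    · exact ⟨c, hcd.1, d, hcd.2.1, hcd.2.2, hc, hPb⟩
    · exact ih hc

theorem isStrong_of_hub (G : Tournament V) (S : Set V) (x : V)
    (hto : ∀ a ∈ S, Relation.ReflTransGen (fun x y => x ∈ S ∧ y ∈ S ∧ G.Adj x y) a x)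
    (hfrom : ∀ a ∈ S, Relation.ReflTransGen (fun x y => x ∈ S ∧ y ∈ S ∧ G.Adj x y) x a) :
    G.IsStrong S :=
  fun a ha b hb => (hto a ha).trans (hfrom b hb)

theorem IsStrong.insert_of_adj {G : Tournament V} {S : Set V} (hS : G.IsStrong S) {v a b : V}
    (ha : a ∈ S) (hb : b ∈ S) (hav : G.Adj a v) (hvb : G.Adj v b) :
    G.IsStrong (insert v S) := by
  have hmono : ∀ x ∈ S, ∀ y ∈ S, Relation.ReflTransGen
      (fun x y => x ∈ insert v S ∧ y ∈ insert v S ∧ G.Adj x y) x y := fun x hx y hy =>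
    Relation.ReflTransGen.mono (fun _ _ h => ⟨.inr h.1, .inr h.2.1, h.2.2⟩) x y (hS x hx y hy)
  refine isStrong_of_hub G _ v ?_ ?_
  · rintro x (rfl | hx)
    · exact .refl
    · exact (hmono x hx a ha).tail ⟨.inr ha, .inl rfl, hav⟩
  · rintro x (rfl | hx)
    · exact .refl
    · exact .head ⟨.inl rfl, .inr hb, hvb⟩ (hmono b hb x hx)

theorem isStrong_triangle (G : Tournament V) {a b c : V} (h1 : G.Adj a b) (h2 : G.Adj b c)
    (h3 : G.Adj c a) : G.IsStrong {a, b, c} := by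
  refine isStrong_of_hub G _ a ?_ ?_
  · rintro x (rfl | rfl | rfl)
    · exact .refl
    · exact .head ⟨by simp, by simp, h2⟩ (.single ⟨by simp, by simp, h3⟩)
    · exact .single ⟨by simp, by simp, h3⟩
  · rintro x (rfl | rfl | rfl)
    · exact .refl
    · exact .single ⟨by simp, by simp, h1⟩
    · exact .head ⟨by simp, by simp, h1⟩ (.single ⟨by simp, by simp, h2⟩)

/-- `h 0, …, h l` is a directed walk in `S` from `a` to `b`. -/
def IsWalk (G : Tournament V) (S : Set V) (a b : V) (l : ℕ) (h : ℕ → V) : Prop :=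
  h 0 = a ∧ h l = b ∧ (∀ i ≤ l, h i ∈ S) ∧ ∀ i < l, G.Adj (h i) (h (i + 1))

theorem IsStrong.exists_walk {G : Tournament V} {S : Set V} (hS : G.IsStrong S) {a b : V}
    (ha : a ∈ S) (hb : b ∈ S) : ∃ l h, G.IsWalk S a b l h := by
  have h := hS a ha b hb
  clear hb
  induction h with
  | refl => exact ⟨0, fun _ => a, rfl, rfl, fun _ _ => ha, fun i hi => absurd hi (by omega)⟩
  | @tail c d _ hcd ih =>
    obtain ⟨l, h, h0, hl, hmem, hadj⟩ := ih
    refine ⟨l + 1, fun n => if n ≤ l then h n else d, by simpa using h0, by simp, ?_, ?_⟩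
    · intro i _
      by_cases hi : i ≤ l
      · simpa [hi] using hmem i hi
      · simpa [hi] using hcd.2.1
    · intro i hi
      rcases Nat.lt_succ_iff_lt_or_eq.1 hi with h' | rfl
      · simpa [h'.le, Nat.succ_le_of_lt h'] using hadj i h'
      · simpa [hl] using hcd.2.2

/-- In a shortest walk, every arc other than those of the walk points backwards. -/
theorem IsStrong.exists_shortest_walk {G : Tournament V} {S : Set V} (hS : G.IsStrong S) {a b : V}
    (ha : a ∈ S) (hb : b ∈ S) : ∃ l h, G.IsWalk S a b l h ∧
      ∀ i j, i + 2 ≤ j → j ≤ l → G.Adj (h j) (h i) := by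
  classical
  have hex := hS.exists_walk ha hb
  obtain ⟨h, hw⟩ := Nat.find_spec hex
  have hmin := fun m => Nat.find_min (m := m) hex
  generalize Nat.find hex = l at hw hmin
  obtain ⟨h0, hl, hmem, hadj⟩ := hw
  refine ⟨l, h, ⟨h0, hl, hmem, hadj⟩, fun i j hij hjl => ?_⟩
  by_contra hn
  -- A repeated vertex lets the loop be cut out; a forward arc from `h i` to `h j` is a shortcut.
  by_cases he : h i = h j
  · refine hmin (l - (j - i)) (by omega)
      ⟨fun n => if n ≤ i then h n else h (n + (j - i)), by simpa using h0, ?_, ?_, ?_⟩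
    · dsimp only
      split_ifs with hc
      · have h1 : j = l := by omega
        have h2 : l - (j - i) = i := by omega
        rw [h2, he, h1, hl]
      · rw [← hl]; congr 1; omega
    · intro n hn'
      dsimp only
      split_ifs with hc <;> exact hmem _ (by omega)
    · intro n hn'
      dsimp only
      split_ifs with hc hc' hc'
      · exact hadj _ (by omega)
      · have h1 : n = i := by omega
        subst h1
        rw [he, show n + 1 + (j - n) = j + 1 by omega]
        exact hadj _ (by omega)
      · omega
      · rw [show n + 1 + (j - i) = n + (j - i) + 1 by omega]
        exact hadj _ (by omega)
  · have hadj' := (G.adj_or he).resolve_right hn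
    refine hmin (l - (j - i - 1)) (by omega)
      ⟨fun n => if n ≤ i then h n else h (n + (j - i - 1)), by simpa using h0, ?_, ?_, ?_⟩
    · dsimp only
      rw [if_neg (by omega), ← hl]; congr 1; omega
    · intro n hn'
      dsimp only
      split_ifs with hc <;> exact hmem _ (by omega)
    · intro n hn'
      dsimp only
      split_ifs with hc hc' hc'
      · exact hadj _ (by omega)
      · have h1 : n = i := by omega
        subst h1
        rw [show n + 1 + (j - n - 1) = j by omega]
        exact hadj'
      · omega
      · rw [show n + 1 + (j - i - 1) = n + (j - i - 1) + 1 by omega]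
        exact hadj _ (by omega)

/-! ### Cyclic colourings -/

/-- `f` increases by one along every arc of every cyclic triangle inside `S`. -/
def IsCyclicColoring (G : Tournament V) (S : Set V) (f : V → ZMod 3) : Prop :=
  ∀ a ∈ S, ∀ b ∈ S, ∀ c ∈ S, G.Adj a b → G.Adj b c → G.Adj c a → f b = f a + 1

/-- A shortest walk in `S` from `b` to `a` closing a cyclic triangle with a vertex outside `S`
has length two or five. -/
theorem walk_length_eq_two_or_five {G : Tournament V} (hT : G.NoT5) (hU : G.NoU5)
    (hN : G.NoBlowup) {S : Set V} {v a b : V} {l : ℕ} {h : ℕ → V} (hv : v ∉ S)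
    (hw : G.IsWalk S b a l h) (hback : ∀ i j, i + 2 ≤ j → j ≤ l → G.Adj (h j) (h i))
    (hva : G.Adj v a) (hab : G.Adj a b) (hbv : G.Adj b v) : l = 2 ∨ l = 5 := by
  obtain ⟨rfl, rfl, hmem, hadj⟩ := hw
  have hne : ∀ i ≤ l, h i ≠ v := fun i hi e => hv (e ▸ hmem i hi)
  have hl0 : l ≠ 0 := by rintro rfl; exact G.loopless _ hab
  have hl1 : l ≠ 1 := by rintro rfl; exact G.adj_asymm hab (hadj 0 (by omega))
  by_contra hcon
  have h3l : 3 ≤ l := by omega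
  have a01 := hadj 0 (by omega)
  have a12 := hadj 1 (by omega)
  have a23 := hadj 2 (by omega)
  have a20 := hback 0 2 (by omega) (by omega)
  have a30 := hback 0 3 (by omega) (by omega)
  have a31 := hback 1 3 (by omega) (by omega)
  have e3 : ¬ G.Adj v (h 3) := not_adj_of_four_path hT hU hN a01 a12 a23 a20 a30 a31
    (hne 1 (by omega)) (hne 2 (by omega)) hbv
  have h4l : 4 ≤ l := by
    rcases Nat.lt_or_ge l 4 with h' | h'
    · obtain rfl : l = 3 := by omega
      exact absurd hva e3
    · exact h'
  -- Since `4 ≤ l`, the end `h l` dominates the triangle on `h 0`, `h 1`, `h 2`, of which `v` can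
  -- then have only one in-neighbour, namely `h 0`.
  have e2 : ¬ G.Adj (h 2) v := fun h2 =>
    not_adj_of_dominated_triangle hU hN a20 a01 a12 (hback _ _ (by omega) le_rfl)
      (hback _ _ (by omega) le_rfl) (hback _ _ (by omega) le_rfl) hva (hne 1 (by omega)) h2 hbv
  have e2' := (G.adj_or (hne 2 (by omega))).resolve_left e2
  have a34 := hadj 3 (by omega)
  have a42 := hback 2 4 (by omega) (by omega)
  have a40 := hback 0 4 (by omega) (by omega)
  -- Dually, the triangle on `h 2`, `h 3`, `h 4` dominates `h 0`, and `v` already dominates `h 2`.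
  have e4 : ¬ G.Adj v (h 4) := fun h4 =>
    not_adj_of_dominating_triangle hU hN a42 a23 a34 a40 a20 a30 hbv (hne 3 (by omega)) h4 e2'
  have h6l : 6 ≤ l := by
    rcases Nat.lt_or_ge l 5 with h' | h'
    · obtain rfl : l = 4 := by omega
      exact absurd hva e4
    · omega
  -- For `6 ≤ l` the end also dominates `h 4`, so `h 3` and `h 4` cannot both dominate `v`. For `l =
  -- 5` the arc goes from `h 4` to `h 5`, and the argument breaks down.
  exact not_adj_of_dominated_triangle hU hN a34 a42 a23 (hback _ _ (by omega) le_rfl)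
    (hback _ _ (by omega) le_rfl) (hback _ _ (by omega) le_rfl) hva (hne 2 (by omega))
    ((G.adj_or (hne 3 (by omega))).resolve_right e3)
    ((G.adj_or (hne 4 (by omega))).resolve_right e4)

theorem IsCyclicColoring.apply_eq_add_one {G : Tournament V} (hT : G.NoT5) (hU : G.NoU5)
    (hN : G.NoBlowup) {S : Set V} {f : V → ZMod 3} (hf : G.IsCyclicColoring S f)
    (hS : G.IsStrong S) {v a b : V} (hv : v ∉ S) (ha : a ∈ S) (hb : b ∈ S)
    (hva : G.Adj v a) (hab : G.Adj a b) (hbv : G.Adj b v) : f b = f a + 1 := by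
  obtain ⟨l, h, hw, hback⟩ := hS.exists_shortest_walk hb ha
  have hl := walk_length_eq_two_or_five hT hU hN hv hw hback hva hab hbv
  obtain ⟨rfl, rfl, hmem, hadj⟩ := hw
  -- Three consecutive walk vertices form a cyclic triangle, so `f` rises by one per step. Both
  -- lengths are `2` modulo `3`, whence the total rise is the same.
  have hstep : ∀ i, i + 2 ≤ l → f (h (i + 1)) = f (h i) + 1 := fun i hi =>
    hf _ (hmem _ (by omega)) _ (hmem _ (by omega)) _ (hmem (i + 2) hi)
      (hadj i (by omega)) (hadj (i + 1) (by omega)) (hback i (i + 2) le_rfl hi)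
  have hlast : ∀ i, i + 2 ≤ l → f (h (i + 2)) = f (h (i + 1)) + 1 := fun i hi =>
    hf _ (hmem _ (by omega)) _ (hmem (i + 2) hi) _ (hmem i (by omega))
      (hadj (i + 1) (by omega)) (hback i (i + 2) le_rfl hi) (hadj i (by omega))
  rcases hl with rfl | rfl
  · rw [hlast 0 (by omega), hstep 0 (by omega)]
    generalize f (h 0) = x
    revert x; decide
  · rw [hlast 3 (by omega), hstep 3 (by omega), hstep 2 (by omega), hstep 1 (by omega),
      hstep 0 (by omega)]
    generalize f (h 0) = x
    revert x; decide

/-- The colour of `v` must be one less than that of `a` in each triangle `v → a → b → v`. Two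
triangles agree because a linking third one compares them. -/
theorem IsCyclicColoring.exists_insert {G : Tournament V} (hT : G.NoT5) (hU : G.NoU5)
    (hN : G.NoBlowup) {S : Set V} {f : V → ZMod 3} (hf : G.IsCyclicColoring S f)
    (hS : G.IsStrong S) {v : V} (hv : v ∉ S) :
    ∃ g, G.IsCyclicColoring (insert v S) g := by
  classical
  have key := fun {a b : V} (ha : a ∈ S) (hb : b ∈ S) =>
    hf.apply_eq_add_one (v := v) (a := a) (b := b) hT hU hN hS hv ha hb
  obtain ⟨k, hk⟩ : ∃ k : ZMod 3, ∀ a ∈ S, ∀ b ∈ S, G.Adj v a → G.Adj a b → G.Adj b v →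
      f a = k + 1 := by
    by_cases hex : ∃ a ∈ S, ∃ b ∈ S, G.Adj v a ∧ G.Adj a b ∧ G.Adj b v
    · obtain ⟨a, ha, b, hb, h1, h2, h3⟩ := hex
      refine ⟨f a - 1, fun c hc d hd h4 h5 h6 => ?_⟩
      have e1 := key ha hb h1 h2 h3
      have e2 := key hc hd h4 h5 h6
      rcases adj_or_adj_of_two_triangles hU hN h1 h2 h3 h4 h5 h6 with h | h
      · have e3 := key ha hd h1 h h6
        rw [sub_add_cancel]
        exact add_right_cancel (e2.symm.trans e3)
      · have e3 := key hc hb h4 h h3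
        rw [sub_add_cancel]
        exact add_right_cancel (e3.symm.trans e1)
    · exact ⟨0, fun a ha b hb h1 h2 h3 => absurd ⟨a, ha, b, hb, h1, h2, h3⟩ hex⟩
  have hfS : ∀ x ∈ S, Function.update f v k x = f x := fun x hx =>
    Function.update_of_ne (fun e : x = v => hv (e ▸ hx)) _ _
  have hmem : ∀ x ∈ insert v S, x ≠ v → x ∈ S := fun x hx hne => hx.resolve_left hne
  have hthree : ∀ x : ZMod 3, x = x + 1 + 1 + 1 := by decide
  refine ⟨Function.update f v k, fun a ha b hb c hc h1 h2 h3 => ?_⟩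
  by_cases hav : a = v
  · subst hav
    have hb' := hmem b hb (G.adj_ne h1).symm
    have hc' := hmem c hc (G.adj_ne h3)
    rw [hfS b hb', Function.update_self]
    exact hk b hb' c hc' h1 h2 h3
  have ha' := hmem a ha hav
  by_cases hbv : b = v
  · subst hbv
    have hc' := hmem c hc (G.adj_ne h2).symm
    rw [hfS a ha', Function.update_self, key hc' ha' h2 h3 h1, hk c hc' a ha' h2 h3 h1]
    exact hthree k
  have hb' := hmem b hb hbv
  rw [hfS a ha', hfS b hb']
  by_cases hcv : c = v
  · subst hcv
    exact key ha' hb' h3 h1 h2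
  · exact hf a ha' b hb' c (hmem c hc hcv) h1 h2 h3

theorem exists_isCyclicColoring_triangle (G : Tournament V) {a b c : V} (h1 : G.Adj a b)
    (h2 : G.Adj b c) (h3 : G.Adj c a) : ∃ f, G.IsCyclicColoring {a, b, c} f := by
  classical
  have hab := G.adj_ne h1
  have hbc := G.adj_ne h2
  have hca := G.adj_ne h3
  have n1 := G.adj_asymm h1
  have n2 := G.adj_asymm h2
  have n3 := G.adj_asymm h3
  have hl := G.loopless
  refine ⟨fun x => if x = a then 0 else if x = b then 1 else 2, ?_⟩
  have h23 : (2 : ZMod 3) + 1 = 0 := by decide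
  have h12 : (1 : ZMod 3) + 1 = 2 := by decide
  rintro x (rfl | rfl | rfl) y (rfl | rfl | rfl) z (rfl | rfl | rfl) k1 k2 k3 <;>
    first
    | exact absurd k1 (hl _)
    | exact absurd k1 ‹_›
    | simp [hab.symm, hbc.symm, hca, h23, h12]

/-! ### Prime tournaments -/

theorem IsPrime.subsingleton_or_eq_univ [Finite V] {G : Tournament V} (hG : G.IsPrime)
    {X : Set V} (hX : G.IsHomogeneous X) : X.Subsingleton ∨ X = Set.univ := by
  by_contra hcon
  push Not at hcon
  refine hG X hX ⟨?_, ?_⟩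
  · exact Set.one_lt_ncard_iff_nontrivial.2 hcon.1
  · rw [← Set.ncard_univ]
    exact Set.ncard_lt_ncard (Set.ssubset_univ_iff.2 hcon.2) (Set.toFinite _)

/-- A prime tournament with at least three vertices is strongly connected. -/
theorem IsPrime.isStrong_univ [Finite V] {G : Tournament V} (hG : G.IsPrime)
    (hV : 2 < Nat.card V) : G.IsStrong Set.univ := by
  intro a _
  set R : Set V := {x | Relation.ReflTransGen
    (fun x y => x ∈ Set.univ ∧ y ∈ Set.univ ∧ G.Adj x y) a x}
  have hout : ∀ v ∉ R, ∀ x ∈ R, G.Adj v x := by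
    intro v hv x hx
    refine (G.adj_or fun e : v = x => hv (e ▸ hx)).resolve_right fun h => hv ?_
    exact Relation.ReflTransGen.tail hx ⟨trivial, trivial, h⟩
  have haR : a ∈ R := Relation.ReflTransGen.refl
  rcases hG.subsingleton_or_eq_univ (X := R) fun v hv => .inl (hout v hv) with h | h
  · exfalso
    have hRa : R = {a} := h.eq_singleton_of_mem haR
    -- When `a` reaches only itself, all other vertices dominate it.
    have hhom : G.IsHomogeneous {a}ᶜ := by
      intro v hv
      have hva : v = a := by simpa using hv
      subst hva
      exact .inr fun x hx => hout x (by rw [hRa]; exact hx) _ haR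
    have hcard := Set.ncard_add_ncard_compl ({a} : Set V)
    rw [Set.ncard_singleton] at hcard
    exact hG _ hhom ⟨by omega, by omega⟩
  · intro b _
    have hb : b ∈ R := h ▸ Set.mem_univ b
    exact hb

/-- A nontrivial strong set of a prime `U₅`-free tournament cannot dominate a vertex which
dominates a vertex dominating the set. -/
theorem IsPrime.not_strong_blowup [Finite V] {G : Tournament V} (hG : G.IsPrime) (hU : G.NoU5)
    {A : Set V} (hA : G.IsStrong A) (hnt : A.Nontrivial) {b c : V} (hAb : ∀ a ∈ A, G.Adj a b)
    (hbc : G.Adj b c) (hcA : ∀ a ∈ A, G.Adj c a) : False := by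
  -- By primeness some `v` is mixed on a maximal such `M`. Either `v` can be added to `M`, or `v`,
  -- `b`, `c` and an arc of `M` whose ends relate differently to `v` span a `U₅`.
  obtain ⟨M, hAM, hM⟩ := (Set.toFinite {M : Set V | G.IsStrong M ∧ (∀ a ∈ M, G.Adj a b) ∧
    ∀ a ∈ M, G.Adj c a}).exists_le_maximal ⟨hA, hAb, hcA⟩
  obtain ⟨⟨hMs, hMb, hcM⟩, hmax⟩ := hM
  have hhom : ¬ G.IsHomogeneous M := by
    intro h
    rcases hG.subsingleton_or_eq_univ h with h' | h'
    · exact Set.not_subsingleton_iff.2 (hnt.mono hAM) h'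
    · exact G.loopless b (hMb b (h' ▸ Set.mem_univ b))
  unfold IsHomogeneous at hhom
  push Not at hhom
  obtain ⟨v, hv, ⟨x, hx, hvx⟩, ⟨y, hy, hyv⟩⟩ := hhom
  have hne : ∀ a ∈ M, a ≠ v := fun a ha e => hv (e ▸ ha)
  have hxv := (G.adj_or (hne x hx)).resolve_right hvx
  have hvy := (G.adj_or (hne y hy)).resolve_left hyv
  have hvb : v ≠ b := by rintro rfl; exact hyv (hMb y hy)
  have hvc : v ≠ c := by rintro rfl; exact hvx (hcM x hx)
  obtain ⟨p, hp, q, hq, hpq, hpv, hqv⟩ :=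
    hMs.exists_crossing (fun z => G.Adj z v) hx hy hxv hyv
  obtain ⟨s, hs, r, hr, hsr, hvs, hvr⟩ :=
    hMs.exists_crossing (fun z => G.Adj v z) hy hx hvy hvx
  have hvq := (G.adj_or (hne q hq)).resolve_left hqv
  have hrv := (G.adj_or (hne r hr)).resolve_right hvr
  have hpb := hMb p hp
  have hqb := hMb q hq
  have hcp := hcM p hp
  have hcq := hcM q hq
  have hrb := hMb r hr
  have hsb := hMb s hs
  have hcr := hcM r hr
  have hcs := hcM s hs
  rcases G.adj_or hvb with h1 | h1 <;> rcases G.adj_or hvc with h2 | h2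
  · apply hU b v c s r <;> assumption
  · refine hv (hmax (y := insert v M) ⟨hMs.insert_of_adj hx hy hxv hvy, ?_, ?_⟩
      (Set.subset_insert v M) (Set.mem_insert v M))
    · rintro a (rfl | ha)
      · exact h1
      · exact hMb a ha
    · rintro a (rfl | ha)
      · exact h2
      · exact hcM a ha
  · apply hU q p b v c <;> assumption
  · apply hU v c s r b <;> assumption

theorem IsPrime.noBlowup [Finite V] {G : Tournament V} (hG : G.IsPrime) (hU : G.NoU5) :
    G.NoBlowup := by
  intro a b c x y h1 h2 h3 h4 h5 h6 h7 h8 h9 h10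
  refine hG.not_strong_blowup hU (G.isStrong_triangle h1 h2 h3)
    ⟨a, by simp, b, by simp, G.adj_ne h1⟩ (b := x) (c := y) ?_ h7 ?_
  · rintro z (rfl | rfl | rfl) <;> assumption
  · rintro z (rfl | rfl | rfl) <;> assumption

theorem IsPrime.exists_isCyclicColoring [Finite V] {G : Tournament V} (hG : G.IsPrime)
    (hT : G.NoT5) (hU : G.NoU5) : ∃ f, G.IsCyclicColoring Set.univ f := by
  have hN := hG.noBlowup hU
  by_cases hV : 2 < Nat.card V
  swap
  · refine ⟨0, fun a _ b _ c _ h1 h2 h3 => (hV ?_).elim⟩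
    have h := Set.ncard_le_ncard (Set.subset_univ {a, b, c}) (Set.toFinite _)
    rw [Set.ncard_univ, Set.ncard_eq_three.2
      ⟨a, b, c, G.adj_ne h1, (G.adj_ne h3).symm, G.adj_ne h2, rfl⟩] at h
    omega
  have hstrong := hG.isStrong_univ hV
  obtain ⟨x₀⟩ : Nonempty V := (Nat.card_pos_iff.1 (by omega)).1
  obtain ⟨S, hxS, hS⟩ := (Set.toFinite {S : Set V | G.IsStrong S ∧
    ∃ f, G.IsCyclicColoring S f}).exists_le_maximal (a := {x₀}) ⟨G.isStrong_singleton x₀, 0, by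
      rintro a rfl b rfl c _ h1
      exact absurd h1 (G.loopless _)⟩
  obtain ⟨⟨hSs, f, hf⟩, hmax⟩ := hS
  have hx₀ : x₀ ∈ S := hxS rfl
  by_cases huniv : S = Set.univ
  · exact ⟨f, huniv ▸ hf⟩
  exfalso
  have hunif : ∀ v ∉ S, ∀ a ∈ S, ∀ b ∈ S, G.Adj a v → ¬ G.Adj v b := by
    intro v hv a ha b hb hav hvb
    exact hv (hmax (y := insert v S) ⟨hSs.insert_of_adj ha hb hav hvb,
      hf.exists_insert hT hU hN hSs hv⟩ (Set.subset_insert v S) (Set.mem_insert v S))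
  obtain ⟨w, hw⟩ := (Set.ne_univ_iff_exists_notMem S).1 huniv
  obtain ⟨s, -, q₀, -, hsq, hs, hq₀⟩ :=
    hstrong.exists_crossing (· ∈ S) (Set.mem_univ x₀) (Set.mem_univ w) hx₀ hw
  obtain ⟨p₀, -, t, -, hpt, hp₀, ht⟩ :=
    hstrong.exists_crossing (· ∉ S) (Set.mem_univ w) (Set.mem_univ x₀) hw (not_not.2 hx₀)
  rw [not_not] at ht
  -- An arc leaving the set of outside vertices dominated by `S`. Its head `p` is not in `S`, as `S`
  -- dominates `q`, so `p` dominates `S`.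
  obtain ⟨q, -, p, -, hqp, ⟨hq, hxq⟩, hp⟩ :=
    hstrong.exists_crossing (fun z => z ∉ S ∧ G.Adj s z) (Set.mem_univ q₀) (Set.mem_univ p₀)
      ⟨hq₀, hsq⟩ (fun h => hunif p₀ hp₀ s hs t ht h.2 hpt)
  have hne : ∀ v ∉ S, ∀ a ∈ S, v ≠ a := fun v hv a ha e => hv (e ▸ ha)
  have hSq : ∀ a ∈ S, G.Adj a q := fun a ha =>
    (G.adj_or (hne q hq a ha)).resolve_left (hunif q hq s hs a ha hxq)
  have hpS : p ∉ S := fun h => G.adj_asymm hqp (hSq p h)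
  have hps := (G.adj_or (hne p hpS s hs)).resolve_right fun h => hp ⟨hpS, h⟩
  have hpS' : ∀ a ∈ S, G.Adj p a := fun a ha =>
    (G.adj_or (hne p hpS a ha)).resolve_right fun h => hunif p hpS a ha s hs h hps
  rcases S.subsingleton_or_nontrivial with h | h
  · refine hq (hmax (y := {s, q, p}) ⟨G.isStrong_triangle hxq hqp hps,
      G.exists_isCyclicColoring_triangle hxq hqp hps⟩ ?_ (by simp))
    rw [h.eq_singleton_of_mem hs]
    simp
  · exact hG.not_strong_blowup hU hSs h hSq hqp hpS'

/-! ### Tripartitions into pairwise transitive unions -/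

theorem IsTransitiveSet.not_triangle {G : Tournament V} {X : Set V} (h : G.IsTransitiveSet X)
    {a b c : V} (ha : a ∈ X) (hb : b ∈ X) (hc : c ∈ X) (h1 : G.Adj a b) (h2 : G.Adj b c)
    (h3 : G.Adj c a) : False :=
  h {⟨a, ha⟩, ⟨b, hb⟩, ⟨c, hc⟩} ⟨⟨a, ha⟩, ⟨b, hb⟩, ⟨c, hc⟩,
    fun e => G.adj_ne h1 (congrArg Subtype.val e), fun e => G.adj_ne h2 (congrArg Subtype.val e),
    fun e => G.adj_ne h3 (congrArg Subtype.val e), rfl, h1, h2, h3⟩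

theorem IsCyclicColoring.isTransitiveSet {G : Tournament V} {f : V → ZMod 3}
    (hf : G.IsCyclicColoring Set.univ f) {X : Set V} (k : ZMod 3) (hX : ∀ x ∈ X, f x ≠ k) :
    G.IsTransitiveSet X := by
  rintro _ ⟨a, b, c, -, -, -, -, h1, h2, h3⟩
  have e1 := hf a trivial b trivial c trivial h1 h2 h3
  have e2 := hf b trivial c trivial a trivial h2 h3 h1
  have na := hX a a.2
  have nb := hX b b.2
  have nc := hX c c.2
  rw [e2, e1] at nc
  rw [e1] at nb
  generalize f a = x at na nb nc
  clear hX
  revert na nb nc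
  revert x k
  decide

theorem IsCyclicColoring.exists_tripartition {G : Tournament V} {f : V → ZMod 3}
    (hf : G.IsCyclicColoring Set.univ f) : ∃ X Y Z : Set V, IsTripartition X Y Z ∧
      G.IsTransitiveSet (X ∪ Y) ∧ G.IsTransitiveSet (Y ∪ Z) ∧ G.IsTransitiveSet (Z ∪ X) := by
  have hdisj : ∀ i j : ZMod 3, i ≠ j → Disjoint (f ⁻¹' {i}) (f ⁻¹' {j}) := fun i j hij =>
    Disjoint.preimage f (Set.disjoint_singleton.2 hij)
  have hcover : ∀ x : ZMod 3, (x = 0 ∨ x = 1) ∨ x = 2 := by decide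
  refine ⟨f ⁻¹' {0}, f ⁻¹' {1}, f ⁻¹' {2}, ⟨?_, hdisj _ _ (by decide), hdisj _ _ (by decide),
    hdisj _ _ (by decide)⟩, hf.isTransitiveSet 2 ?_, hf.isTransitiveSet 0 ?_,
    hf.isTransitiveSet 1 ?_⟩
  · exact Set.eq_univ_of_forall fun x => hcover (f x)
  all_goals
    rintro x (hx | hx) <;>
    · have hx' : f x = _ := hx
      rw [hx']
      decide

/-- A tournament with four vertices any two of which lie in a common cyclic triangle does not occur
in a tournament with a tripartition into pairwise transitive unions. -/
theorem free_of_tripartition {G : Tournament V} {H : Tournament W} (s : Finset W)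
    (hs : 3 < s.card)
    (hH : ∀ i ∈ s, ∀ j ∈ s, i ≠ j → ∃ k, (H.Adj i j ∧ H.Adj j k ∧ H.Adj k i) ∨
      (H.Adj j i ∧ H.Adj i k ∧ H.Adj k j))
    {X Y Z : Set V} (hp : IsTripartition X Y Z) (hXY : G.IsTransitiveSet (X ∪ Y))
    (hYZ : G.IsTransitiveSet (Y ∪ Z)) (hZX : G.IsTransitiveSet (Z ∪ X)) : G.Free H := by
  by_contra hfree
  obtain ⟨g, hg⟩ := exists_hom_of_not_free G H hfree
  have hcov : ∀ v, ∃ i : Fin 3, v ∈ (![X, Y, Z] : Fin 3 → Set V) i := fun v => by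
    have h : v ∈ X ∪ Y ∪ Z := hp.1 ▸ Set.mem_univ v
    rcases h with (h | h) | h
    · exact ⟨0, h⟩
    · exact ⟨1, h⟩
    · exact ⟨2, h⟩
  choose col hcol using hcov
  have htrans : ∀ i j : Fin 3, ∃ P, G.IsTransitiveSet P ∧
      (![X, Y, Z] : Fin 3 → Set V) i ⊆ P ∧ (![X, Y, Z] : Fin 3 → Set V) j ⊆ P := by
    intro i j
    fin_cases i <;> fin_cases j
    · exact ⟨_, hXY, Set.subset_union_left, Set.subset_union_left⟩
    · exact ⟨_, hXY, Set.subset_union_left, Set.subset_union_right⟩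
    · exact ⟨_, hZX, Set.subset_union_right, Set.subset_union_left⟩
    · exact ⟨_, hXY, Set.subset_union_right, Set.subset_union_left⟩
    · exact ⟨_, hXY, Set.subset_union_right, Set.subset_union_right⟩
    · exact ⟨_, hYZ, Set.subset_union_left, Set.subset_union_right⟩
    · exact ⟨_, hZX, Set.subset_union_left, Set.subset_union_right⟩
    · exact ⟨_, hYZ, Set.subset_union_right, Set.subset_union_left⟩
    · exact ⟨_, hYZ, Set.subset_union_right, Set.subset_union_right⟩
  -- A triangle with two vertices in one part lies in a union of two parts.
  have hne : ∀ u v w, col u = col v → G.Adj u v → G.Adj v w → G.Adj w u → False := by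
    intro u v w huv h1 h2 h3
    obtain ⟨P, hP, hu, hw⟩ := htrans (col u) (col w)
    exact hP.not_triangle (hu (hcol u)) (hu (huv ▸ hcol v)) (hw (hcol w)) h1 h2 h3
  obtain ⟨i, hi, j, hj, hij, he⟩ := Finset.exists_ne_map_eq_of_card_lt_of_maps_to
    (t := Finset.univ) (f := fun i => col (g i)) (by simpa using hs) (fun _ _ => by simp)
  obtain ⟨k, ⟨h1, h2, h3⟩ | ⟨h1, h2, h3⟩⟩ := hH i hi j hj hij
  · exact hne _ _ _ he (hg _ _ h1) (hg _ _ h2) (hg _ _ h3)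
  · exact hne _ _ _ he.symm (hg _ _ h1) (hg _ _ h2) (hg _ _ h3)

end Tournament

theorem mainTheorem2 {V : Type*} [Finite V] (G : Tournament V) (hG : G.IsPrime) :
    (G.Free Tournament.T5 ∧ G.Free Tournament.U5) ↔
      ∃ X Y Z : Set V, Tournament.IsTripartition X Y Z ∧
        G.IsTransitiveSet (X ∪ Y) ∧ G.IsTransitiveSet (Y ∪ Z) ∧ G.IsTransitiveSet (Z ∪ X) := by
  constructor
  · rintro ⟨hT, hU⟩
    obtain ⟨f, hf⟩ := hG.exists_isCyclicColoring hT.noT5 hU.noU5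
    exact hf.exists_tripartition
  · rintro ⟨X, Y, Z, hp, hXY, hYZ, hZX⟩
    -- Here `5` is `0` in `ZMod 5`. In `U₅` the pair `v₁`, `v₂` lies in no cyclic triangle, so `v₂`
    -- is left out; in `T₅` any four vertices would do.
    exact ⟨Tournament.free_of_tripartition {1, 3, 4, 5} (by decide)
        (by unfold Tournament.T5; decide) hp hXY hYZ hZX,
      Tournament.free_of_tripartition {1, 3, 4, 5} (by decide)
        (by unfold Tournament.U5; decide) hp hXY hYZ hZX⟩
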